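/- Let $n\ge 0$ be an integer, $R=\mathbb{Z}[x]$, and let $\mathcal{A}_n$ be the Temperley--Lieb algebra: the unital associative $R$-algebra generated by $e_1,\dots,e_{n-1}$ with relations $e_i^2=xe_i$, $e_ie_{i\pm1}e_i=e_i$, and $e_ie_j=e_je_i$ for $|i-j|\ge 2$. A partition of $n$ is a pair $\lambda=(f,n-2f)$ with $0\le 2f\le n$; for partitions of the same $n$ write $(i,n-2i)\unrhd(j,n-2j)$ if $i\ge j$, and $\rhd$ for the strict relation. A tableau of shape $\lambda$ is a sequence $\mathfrak{t}=(\lambda^{(0)},\dots,\lambda^{(n)})$, where $\lambda^{(k)}$ is a partition of $k$, $\lambda^{(0)}=(0,0)$, $\lambda^{(n)}=\lambda$, and, for $1\le k\le n$, if $\lambda^{(k)}=(i,k-2i)$ then $\lambda^{(k-1)}=(i,k-1-2i)$ or $\lambda^{(k-1)}=(i-1,k-2i+1)$. Let $\mathfrak{T}_n(\lambda)$ be the set of these tableaux. For $\mathfrak{s},\mathfrak{t}\in\mathfrak{T}_n(\lambda)$ write $\mathfrak{s}\unrhd\mathfrak{t}$ if the $k$-th entry of $\mathfrak{s}$ is $\unrhd$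 the $k$-th entry of $\mathfrak{t}$ for all $1\le k\le n$, and $\mathfrak{s}\rhd\mathfrak{t}$ if moreover $\mathfrak{s}\ne\mathfrak{t}$. For $\lambda=(f,n-2f)$ let $m_\lambda=e_1e_3\cdots e_{2f-1}$ (so $m_\lambda=1$ if $f=0$), let $\check{\mathcal{A}}_n^\lambda$ be the sum over all partitions $\mu\rhd\lambda$ of $n$ of the two-sided ideals generated by $m_\mu$, and let the cell module $C^\lambda$ be the right $\mathcal{A}_n$-submodule of $\mathcal{A}_n/\check{\mathcal{A}}_n^\lambda$ generated by the class of $m_\lambda$. For $\mathfrak{t}=(\lambda^{(0)},\dots,\lambda^{(n)})\in\mathfrak{T}_n(\lambda)$ define $v_0,\dots,v_n\in\mathcal{A}_n$ by $v_0=1$ and, for $1\le k\le n$ with $\lambda^{(k)}=(i,k-2i)$, $$v_k=\begin{cases}v_{k-1},&\lambda^{(k-1)}=(i,k-1-2i),\\ e_{2i}e_{2i+1}\cdots e_{k-1}\,v_{k-1},&\lambda^{(k-1)}=(i-1,k-2i+1)\end{cases}$$ (an empty product is $1$), and put $v_\mathfrak{t}=v_n$. The Murphy basis element $m_\mathfrak{t}\in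 C^\lambda$ is the class of $m_\lambda v_\mathfrak{t}$. Define $T_0=T_1=0$, $T_2=e_1$ and, for $2\le i<n$, $$T_{i+1}=-e_iT_i-T_ie_i+e_ie_{i-1}T_ie_i-z_{i-1}-e_iz_{i-2},\qquad z_i=\sum_{k=0}^{i}x^kT_{i-k}.$$ Define $p_0=0$, $p_1=1$, $p_{i+1}=xp_i-p_{i-1}$ in $R$. For $\mathfrak{t}=(\lambda^{(0)},\dots,\lambda^{(n)})\in\mathfrak{T}_n(\lambda)$ put $r_\mathfrak{t}(0)=r_\mathfrak{t}(1)=0$ and, for $2\le k\le n$ with $\lambda^{(k)}=(i,k-2i)$, $$r_\mathfrak{t}(k)=\begin{cases}(p_i-xp_{i-1})\,p_{k-i+1},&\lambda^{(k-1)}=(i-1,k-2i+1),\\(p_{k-i+1}-xp_{k-i})\,p_i,&\lambda^{(k-1)}=(i,k-2i-1).\end{cases}$$ Then for every partition $\lambda$ of $n$, every $\mathfrak{t}\in\mathfrak{T}_n(\lambda)$ and every integer $0\le k\le n$ there exist $a_\mathfrak{v}\in R$, for $\mathfrak{v}\in\mathfrak{T}_n(\lambda)$, such that in $C^\lambda$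 $$m_\mathfrak{t}T_k=r_\mathfrak{t}(k)\,m_\mathfrak{t}+\sum_{\mathfrak{v}\rhd\mathfrak{t}}a_\mathfrak{v}m_\mathfrak{v},$$ the sum running over $\mathfrak{v}\in\mathfrak{T}_n(\lambda)$ with $\mathfrak{v}\rhd\mathfrak{t}$. -/

import Mathlib

open Polynomial

noncomputable section

namespace TemperleyLieb

/-! ### The algebra -/

/-- Labels `1, …, n - 1` of the generators. -/
abbrev Gen (n : ℕ) : Type := {i : ℕ // 1 ≤ i ∧ i < n}

/-- The defining relations, over the ground ring `ℤ[X]`. -/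
inductive Rel (n : ℕ) : FreeAlgebra ℤ[X] (Gen n) → FreeAlgebra ℤ[X] (Gen n) → Prop
  | sq (i : Gen n) :
      Rel n (FreeAlgebra.ι ℤ[X] i * FreeAlgebra.ι ℤ[X] i) ((X : ℤ[X]) • FreeAlgebra.ι ℤ[X] i)
  | braid (i j : Gen n) (h : i.1 + 1 = j.1 ∨ j.1 + 1 = i.1) :
      Rel n (FreeAlgebra.ι ℤ[X] i * FreeAlgebra.ι ℤ[X] j * FreeAlgebra.ι ℤ[X] i)
        (FreeAlgebra.ι ℤ[X] i)
  | comm (i j : Gen n) (h : i.1 + 2 ≤ j.1 ∨ j.1 + 2 ≤ i.1) :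
      Rel n (FreeAlgebra.ι ℤ[X] i * FreeAlgebra.ι ℤ[X] j)
        (FreeAlgebra.ι ℤ[X] j * FreeAlgebra.ι ℤ[X] i)

/-- The Temperley–Lieb algebra on `n` strands over `ℤ[X]` with loop parameter `X`. -/
def TL (n : ℕ) : Type := RingQuot (Rel n)

instance instRingTL (n : ℕ) : Ring (TL n) := inferInstanceAs (Ring (RingQuot (Rel n)))

instance instAlgebraTL (n : ℕ) : Algebra ℤ[X] (TL n) :=
  inferInstanceAs (Algebra ℤ[X] (RingQuot (Rel n)))

/-- The quotient map from the free algebra. -/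
def TL.mk (n : ℕ) : FreeAlgebra ℤ[X] (Gen n) →ₐ[ℤ[X]] TL n := RingQuot.mkAlgHom ℤ[X] (Rel n)

/-- The generator `e_i` for `1 ≤ i ≤ n - 1` (and `0` for other indices, which never occur in the
elements used below). -/
def e (n i : ℕ) : TL n :=
  if h : 1 ≤ i ∧ i < n then TL.mk n (FreeAlgebra.ι ℤ[X] ⟨i, h⟩) else 0

/-- `w_{i,j} = e_i e_{i+1} ⋯ e_{j-1}` for `i ≤ j` (the empty product if `i = j`). -/
def w (n i j : ℕ) : TL n := ((List.range' i (j - i)).map (e n)).prod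

/-! ### Partitions and tableaux -/

/-- A partition of `n` is a pair `(i, n - 2 i)` with `0 ≤ 2 i ≤ n`. -/
@[ext]
structure Partition (n : ℕ) where
  fst : ℕ
  snd : ℕ
  sum_eq : 2 * fst + snd = n

/-- `μ → lam`, for `μ` a partition of `m` and `lam` a partition of `m + 1`. -/
def Arrow {m : ℕ} (μ : Partition m) (lam : Partition (m + 1)) : Prop :=
  (μ.fst = lam.fst ∧ μ.snd + 1 = lam.snd) ∨ (μ.fst + 1 = lam.fst ∧ μ.snd = lam.snd + 1)

/-- A tableau `(lam⁽⁰⁾, …, lam⁽ⁿ⁾)` of shape `lam`. -/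
@[ext]
structure Tableau {n : ℕ} (lam : Partition n) where
  shape : (k : Fin (n + 1)) → Partition k
  shape_zero : (shape 0).fst = 0 ∧ (shape 0).snd = 0
  step : ∀ k : Fin n, Arrow (m := k) (shape k.castSucc) (shape k.succ)
  shape_last : shape (Fin.last n) = lam

instance instFintypePartition (n : ℕ) : Fintype (Partition n) :=
  Fintype.ofInjective (β := Fin (n + 1)) (fun p => ⟨p.fst, by have := p.sum_eq; omega⟩) (by
    intro p q h
    have h1 : p.fst = q.fst := congrArg Fin.val h
    have hp := p.sum_eq
    have hq := q.sum_eq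
    exact Partition.ext h1 (by omega))

instance instFintypeTableau {n : ℕ} (lam : Partition n) : Fintype (Tableau lam) :=
  @Fintype.ofInjective _ _ (Fintype.ofFinite _) Tableau.shape (fun _ _ h => Tableau.ext h)

variable {n : ℕ} {lam : Partition n}

/-- The dominance order on partitions of `n`. -/
def Partition.Dominates (lam μ : Partition n) : Prop := μ.fst ≤ lam.fst

/-- Strict dominance of partitions of `n`. -/
def Partition.StrictDominates (lam μ : Partition n) : Prop := lam.Dominates μ ∧ lam ≠ μ

/-- `lam⁽ᵏ⁾`, the shape of the restriction of the tableau to its first `k` steps. -/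
def Tableau.shapeAt (t : Tableau lam) (k : ℕ) (hk : k ≤ n) : Partition k :=
  t.shape ⟨k, Nat.lt_succ_of_le hk⟩

/-- The dominance order on tableaux of shape `lam`. -/
def Tableau.Dominates (s t : Tableau lam) : Prop :=
  ∀ (k : ℕ) (hk : k ≤ n), 1 ≤ k → (s.shapeAt k hk).Dominates (t.shapeAt k hk)

/-- Strict dominance of tableaux of shape `lam`. -/
def Tableau.StrictDominates (s t : Tableau lam) : Prop := s.Dominates t ∧ s ≠ t

/-! ### Cell modules and the Murphy basis -/

/-- `m_lam = e_1 e_3 ⋯ e_{2f-1}` for `lam = (f, n - 2f)`; it is `1` if `f = 0`. -/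
def mPart (lam : Partition n) : TL n :=
  ((List.range lam.fst).map fun j => e n (2 * j + 1)).prod

/-- The two-sided ideal generated by `m_lam`. -/
def idealOf (lam : Partition n) : TwoSidedIdeal (TL n) := TwoSidedIdeal.span {mPart lam}

/-- The sum of the ideals `idealOf μ` over the `μ` that strictly dominate `lam`. -/
def checkIdeal (lam : Partition n) : TwoSidedIdeal (TL n) :=
  ⨆ (μ : Partition n) (_ : μ.StrictDominates lam), idealOf μ

/-- `checkIdeal lam` as a right submodule of the algebra; right modules are modules over the
opposite ring. -/
def checkRight (lam : Partition n) : Submodule (TL n)ᵐᵒᵖ (TL n) where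
  carrier := {a | a ∈ checkIdeal lam}
  add_mem' ha hb := (checkIdeal lam).add_mem ha hb
  zero_mem' := (checkIdeal lam).zero_mem
  smul_mem' c _ ha := (checkIdeal lam).mul_mem_right _ c.unop ha

/-- The cell module: the right submodule of the quotient of the algebra by `checkIdeal lam`
generated by the class of `m_lam`. -/
def Cell (lam : Partition n) : Submodule (TL n)ᵐᵒᵖ (TL n ⧸ checkRight lam) :=
  Submodule.span (TL n)ᵐᵒᵖ {(checkRight lam).mkQ (mPart lam)}

/-- The class of `m_lam` as an element of the cell module. -/
def cellGen (lam : Partition n) : Cell lam :=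
  ⟨(checkRight lam).mkQ (mPart lam), Submodule.subset_span rfl⟩

/-- The element `v` attached to the restriction of `t` to its first `k` steps, viewed in the
algebra on `n` strands. -/
def Tableau.vAt (t : Tableau lam) : (k : ℕ) → k ≤ n → TL n
  | 0, _ => 1
  | k + 1, hk =>
    if (t.shapeAt k (Nat.le_of_succ_le hk)).fst = (t.shapeAt (k + 1) hk).fst then
      t.vAt k (Nat.le_of_succ_le hk)
    else
      w n (2 * (t.shapeAt (k + 1) hk).fst) (k + 1) * t.vAt k (Nat.le_of_succ_le hk)

/-- The element `v_t`. -/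
def Tableau.v (t : Tableau lam) : TL n := t.vAt n le_rfl

/-- The Murphy basis element `m_t`, the class of `m_lam v_t` in the cell module. -/
def Tableau.m (t : Tableau lam) : Cell lam := MulOpposite.op t.v • cellGen lam

/-! ### Jucys–Murphy elements and their eigenvalues -/

/-- The Jucys–Murphy elements `T_0, T_1, …`; the two sums are `z_{i-1}` and `z_{i-2}`
for `i = k + 2`, see `T_add_three`. -/
def T (n : ℕ) : ℕ → TL n
  | 0 => 0
  | 1 => 0
  | 2 => e n 1
  | k + 3 =>
    -(e n (k + 2) * T n (k + 2)) - T n (k + 2) * e n (k + 2)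
      + e n (k + 2) * e n (k + 1) * T n (k + 2) * e n (k + 2)
      - ∑ j : Fin (k + 2), (X : ℤ[X]) ^ (j : ℕ) • T n (k + 1 - j)
      - e n (k + 2) * ∑ j : Fin (k + 1), (X : ℤ[X]) ^ (j : ℕ) • T n (k - j)
  termination_by k => k
  decreasing_by all_goals omega

/-- `z_i = ∑_{k=0}^{i} x^k T_{i-k}`. -/
def z (n i : ℕ) : TL n := ∑ k ∈ Finset.range (i + 1), (X : ℤ[X]) ^ k • T n (i - k)

/-- The defining recursion of the Jucys–Murphy elements in terms of the `z_i`. -/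
theorem T_add_three (n k : ℕ) :
    T n (k + 3) = -(e n (k + 2) * T n (k + 2)) - T n (k + 2) * e n (k + 2)
      + e n (k + 2) * e n (k + 1) * T n (k + 2) * e n (k + 2)
      - z n (k + 1) - e n (k + 2) * z n k := by
  rw [T, z, z, Finset.sum_range, Finset.sum_range]

/-- `p_0 = 0`, `p_1 = 1`, `p_{i+1} = x p_i - p_{i-1}`. -/
def p : ℕ → ℤ[X]
  | 0 => 0
  | 1 => 1
  | i + 2 => X * p (i + 1) - p i

/-- The eigenvalue `r_t(k)`, for `0 ≤ k ≤ n`. -/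
def Tableau.r (t : Tableau lam) : (k : ℕ) → k ≤ n → ℤ[X]
  | 0, _ => 0
  | 1, _ => 0
  | k + 2, hk =>
    let i := (t.shapeAt (k + 2) hk).fst
    if (t.shapeAt (k + 1) (Nat.le_of_succ_le hk)).fst + 1 = i then
      (p i - X * p (i - 1)) * p (k + 2 - i + 1)
    else
      (p (k + 2 - i + 1) - X * p (k + 2 - i)) * p i

end TemperleyLieb

end

open Polynomial

noncomputable section

namespace TemperleyLieb

/-! ### Relations between the generators -/

/-! The sum z_k satisfies a recursion of its own, that of `Z n 0 k`, from which it is central in the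
subalgebra generated by e_1, …, e_{k-1} (`Z_central_aux`, `z_eq_Z`). Since T_k = z_k - x z_{k-1}, it
is enough that z_k acts triangularly with eigenvalue p_i p_{k-i+1}, where i is the first part of the
k-th entry; r_t(k) is the matching difference.

At length k, v_k is a word in e_1, …, e_{k-1}, so z_k moves past it and meets e_1 e_3 ⋯ e_{2i-1}.
Each of these factors strips two strands off z_k (`e_mul_Z_shift`), leaving the scalar p_i p_{k-i+1}
and the analogue of z on the strands beyond 2i (`mm_mul_Z`). That analogue has no constant term, and
a generator on those strands joins two through strands, which produces multiples of Murphy elements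
of higher paths with larger end (`w_mul_M`, `aug_mul_M_mem_above`).

Such terms vanish in the cell module only at full length: for k < n, a path with larger end may
later return to the shape of t. Both kinds of error are therefore kept in `above` and carried to
length n. Each further step is a left multiplication that preserves these spans (`above_le_of_eq`,
`w_mul_mem_above`); this uses that compressing by m = e_1 e_3 ⋯ e_{2i-1} gives m y m = m c with c
supported beyond strand 2i. -/

theorem e_mul_self (n i : ℕ) : e n i * e n i = (X : ℤ[X]) • e n i := by
  unfold e
  split_ifs with h
  · rw [← map_mul, ← map_smul]
    exact RingQuot.mkAlgHom_rel ℤ[X] (Rel.sq _)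
  · simp

theorem e_braid {n i j : ℕ} (hi : 1 ≤ i) (hi' : i < n) (hj : 1 ≤ j) (hj' : j < n)
    (h : i + 1 = j ∨ j + 1 = i) : e n i * e n j * e n i = e n i := by
  unfold e
  rw [dif_pos ⟨hi, hi'⟩, dif_pos ⟨hj, hj'⟩, ← map_mul, ← map_mul]
  exact RingQuot.mkAlgHom_rel ℤ[X] (Rel.braid _ _ h)

theorem e_commute {n i j : ℕ} (h : i + 2 ≤ j) : Commute (e n i) (e n j) := by
  unfold e
  split_ifs with h1 h2
  · rw [commute_iff_eq, ← map_mul, ← map_mul]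
    exact RingQuot.mkAlgHom_rel ℤ[X] (Rel.comm _ _ (Or.inl h))
  all_goals simp

/-! ### Subalgebras generated by consecutive generators -/

/-- The subalgebra generated by `e_a, …, e_{b-1}`. -/
def seg (n a b : ℕ) : Subalgebra ℤ[X] (TL n) := Algebra.adjoin ℤ[X] (e n '' Set.Ico a b)

theorem e_mem_seg {n a b j : ℕ} (h1 : a ≤ j) (h2 : j < b) : e n j ∈ seg n a b :=
  Algebra.subset_adjoin ⟨j, ⟨h1, h2⟩, rfl⟩

theorem seg_mono {n a b a' b' : ℕ} (h1 : a' ≤ a) (h2 : b ≤ b') : seg n a b ≤ seg n a' b' :=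
  Algebra.adjoin_mono (Set.image_mono (Set.Ico_subset_Ico h1 h2))

theorem commute_of_mem_seg {n a b : ℕ} {c y : TL n}
    (hc : ∀ j, a ≤ j → j < b → Commute c (e n j)) (hy : y ∈ seg n a b) : Commute c y := by
  induction hy using Algebra.adjoin_induction with
  | mem x hx => obtain ⟨j, ⟨h1, h2⟩, rfl⟩ := hx; exact hc j h1 h2
  | algebraMap r => exact Algebra.commute_algebraMap_right r c
  | add x y _ _ hx hy => exact hx.add_right hy
  | mul x y _ _ hx hy => exact hx.mul_right hy

theorem e_commute_seg_of_le {n a b j : ℕ} {y : TL n} (h : b + 1 ≤ j) (hy : y ∈ seg n a b) :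
    Commute (e n j) y :=
  commute_of_mem_seg (fun _ _ h2 => (e_commute (by omega)).symm) hy

theorem e_commute_seg_of_ge {n a b j : ℕ} {y : TL n} (h : j + 2 ≤ a) (hy : y ∈ seg n a b) :
    Commute (e n j) y :=
  commute_of_mem_seg (fun _ h1 _ => e_commute (by omega)) hy

/-! ### Central elements -/

section Abstract

variable {A : Type*} [Ring A] [Algebra ℤ[X] A] {a b U Y W : A} {x q r : ℤ[X]}

/-- In the three lemmas here, a and b play e_{k+2} and e_{k+1}; U, Y, W play `Z n 0` at k+2, k+1, k;
q and r play p_{k+2} and p_{k+1}. The long expression is then `Z n 0 (k + 3)`. -/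
theorem mul_central_step (ha : a * a = x • a) (hY : a * Y = Y * a) :
    a * (x • U - a * U - U * a + x • (a * Y) + q • a - Y)
      = (x • U - a * U - U * a + x • (a * Y) + q • a - Y) * a := by
  have h1 : a * (a * U) = x • (a * U) := by rw [← mul_assoc, ha, smul_mul_assoc]
  have h2 : a * (a * Y) = x • (a * Y) := by rw [← mul_assoc, ha, smul_mul_assoc]
  simp only [mul_add, mul_sub, add_mul, sub_mul, mul_smul_comm, smul_mul_assoc, h1, h2, mul_assoc,
    ha, ← hY]
  module

/-- As a² = x a, the two terms in a U cancel and -a U a remains; expanding that U, the relation a b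
a = a removes b. -/
theorem mul_central_absorb (ha : a * a = x • a) (hY : a * Y = Y * a) (hW : a * W = W * a)
    (haba : a * b * a = a)
    (hU : U = x • Y - b * Y - Y * b + x • (b * W) + r • b - W) :
    a * (x • U - a * U - U * a + x • (a * Y) + q • a - Y)
      = a * Y + (x * q - r) • a := by
  have h1 : a * (a * U) = x • (a * U) := by rw [← mul_assoc, ha, smul_mul_assoc]
  have h2 : a * (a * Y) = x • (a * Y) := by rw [← mul_assoc, ha, smul_mul_assoc]
  have e1 : a * (Y * a) = x • (a * Y) := by rw [← hY, h2]
  have e2 : a * (b * (Y * a)) = a * Y := by rw [← hY, ← mul_assoc, ← mul_assoc, haba]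
  have e3 : a * (Y * (b * a)) = a * Y := by
    rw [← mul_assoc, hY, mul_assoc, ← mul_assoc a, haba]
  have e4 : a * (b * (W * a)) = a * W := by rw [← hW, ← mul_assoc, ← mul_assoc, haba]
  have e5 : a * (b * a) = a := by rw [← mul_assoc, haba]
  have e6 : a * (W * a) = x • (a * W) := by rw [← hW, ← mul_assoc, ha, smul_mul_assoc]
  have h3 : a * (U * a) = (x * x - 2) • (a * Y) + r • a := by
    rw [hU]
    simp only [mul_add, mul_sub, add_mul, sub_mul, mul_smul_comm, smul_mul_assoc, mul_assoc,
      e1, e2, e3, e4, e5, e6]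
    module
  simp only [mul_add, mul_sub, mul_smul_comm, h1, h2, h3, ha]
  module

theorem mul_central_prev (hY : a * Y = Y * a) (hW : a * W = W * a)
    (hbab : b * a * b = b) (hbW : b * W = W * b)
    (hU : U = x • Y - b * Y - Y * b + x • (b * W) + r • b - W)
    (hbU : b * U = b * W + q • b) (hUb : U * b = b * U) :
    b * (x • U - a * U - U * a + x • (a * Y) + q • a - Y)
      = (x • U - a * U - U * a + x • (a * Y) + q • a - Y) * b := by
  have k1 : b * (a * b) = b := by rw [← mul_assoc, hbab]
  have k2 : ∀ t, b * (a * (b * t)) = b * t := fun t => by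
    rw [← mul_assoc, ← mul_assoc, hbab]
  have h1 : b * (a * U) = x • (b * (a * Y)) - b * Y - b * (Y * (a * b)) + x • (b * W) + r • b
      - b * (a * W) := by
    rw [hU]
    simp only [mul_add, mul_sub, mul_smul_comm, k1, k2]
    rw [← mul_assoc a Y b, hY, mul_assoc Y]
  have h2 : U * (a * b) = x • (Y * (a * b)) - b * (Y * (a * b)) - Y * b + x • (b * W) + r • b
      - W * (a * b) := by
    rw [hU]
    have k3 : b * (W * (a * b)) = b * W := by
      rw [← mul_assoc, hbW, mul_assoc, k1]
    simp only [add_mul, sub_mul, smul_mul_assoc, mul_assoc, k1, k3]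
  have h3 : b * (U * a) = b * (a * W) + q • (b * a) := by
    rw [← mul_assoc, hbU, add_mul, smul_mul_assoc, mul_assoc, ← hW]
  have h4 : a * (U * b) = W * (a * b) + q • (a * b) := by
    rw [hUb, hbU, hbW, mul_add, ← mul_assoc, hW, mul_assoc, mul_smul_comm]
  have h5 : a * (Y * b) = Y * (a * b) := by rw [← mul_assoc, hY, mul_assoc]
  simp only [mul_add, mul_sub, add_mul, sub_mul, mul_smul_comm, smul_mul_assoc, mul_assoc, h1, h2,
    h3, h4, h5]
  rw [hUb]
  module

end Abstract

/-- The central elements of the subalgebra generated by `e_{s+1}, …, e_{s+k-1}`. -/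
def Z (n s : ℕ) : ℕ → TL n
  | 0 => 0
  | 1 => 0
  | k + 2 => (X : ℤ[X]) • Z n s (k + 1) - e n (s + k + 1) * Z n s (k + 1)
      - Z n s (k + 1) * e n (s + k + 1) + (X : ℤ[X]) • (e n (s + k + 1) * Z n s k)
      + p (k + 1) • e n (s + k + 1) - Z n s k

theorem Z_add_two (n s k : ℕ) :
    Z n s (k + 2) = (X : ℤ[X]) • Z n s (k + 1) - e n (s + k + 1) * Z n s (k + 1)
      - Z n s (k + 1) * e n (s + k + 1) + (X : ℤ[X]) • (e n (s + k + 1) * Z n s k)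
      + p (k + 1) • e n (s + k + 1) - Z n s k := rfl

theorem p_add_two (k : ℕ) : p (k + 2) = X * p (k + 1) - p k := rfl

theorem Z_mem_seg (n s k : ℕ) : Z n s k ∈ seg n (s + 1) (s + k) := by
  induction k using Nat.strong_induction_on with
  | _ k ih =>
    match k with
    | 0 => exact zero_mem _
    | 1 => exact zero_mem _
    | k + 2 =>
      have h1 := seg_mono le_rfl (by omega) (ih (k + 1) (by omega)) (b' := s + (k + 2))
      have h2 := seg_mono le_rfl (by omega) (ih k (by omega)) (b' := s + (k + 2))
      have h3 : e n (s + k + 1) ∈ seg n (s + 1) (s + (k + 2)) := e_mem_seg (by omega) (by omega)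
      rw [Z]
      exact sub_mem (add_mem (add_mem (sub_mem (sub_mem (Subalgebra.smul_mem _ h1 _)
        (mul_mem h3 h1)) (mul_mem h1 h3)) (Subalgebra.smul_mem _ (mul_mem h3 h2) _))
        (Subalgebra.smul_mem _ h3 _)) h2

theorem e_commute_Z_of_lt {n k j : ℕ} (h : k + 1 ≤ j) : e n j * Z n 0 k = Z n 0 k * e n j :=
  e_commute_seg_of_le (a := 0 + 1) (b := 0 + k) (by omega) (Z_mem_seg n 0 k)

theorem Z_two (n s : ℕ) : Z n s 2 = e n (s + 1) := by simp [Z, p]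

/-- Commutation with the next-to-last generator uses the absorption law one step lower, so both are
proved in one induction. Smaller generators commute with every ingredient of the recursion. -/
theorem Z_central_aux {n k : ℕ} (hk : k ≤ n) :
    (∀ j, 1 ≤ j → j < k → e n j * Z n 0 k = Z n 0 k * e n j) ∧
    (∀ l, k = l + 2 → e n (l + 1) * Z n 0 k = e n (l + 1) * Z n 0 l + p k • e n (l + 1)) := by
  induction k using Nat.strong_induction_on with
  | _ k ih =>
    match k with
    | 0 => exact ⟨by omega, by omega⟩
    | 1 => exact ⟨by omega, by omega⟩
    | 2 =>
      rw [Z_two]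
      refine ⟨fun j h1 h2 => ?_, fun l h => ?_⟩
      · obtain rfl : j = 1 := by omega
        rfl
      · obtain rfl : l = 0 := by omega
        simp [e_mul_self, Z, p]
    | k + 3 =>
      have hsq := e_mul_self n (0 + (k + 1) + 1)
      have hY := e_commute_Z_of_lt (n := n) (k := k + 1) (j := 0 + (k + 1) + 1) (by omega)
      have hW := e_commute_Z_of_lt (n := n) (k := k) (j := 0 + (k + 1) + 1) (by omega)
      have hbW := e_commute_Z_of_lt (n := n) (k := k) (j := 0 + k + 1) (by omega)
      have haba : e n (0 + (k + 1) + 1) * e n (0 + k + 1) * e n (0 + (k + 1) + 1)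
        = e n (0 + (k + 1) + 1) := e_braid (by omega) (by omega) (by omega) (by omega) (by omega)
      have hbab : e n (0 + k + 1) * e n (0 + (k + 1) + 1) * e n (0 + k + 1)
        = e n (0 + k + 1) := e_braid (by omega) (by omega) (by omega) (by omega) (by omega)
      have ih2 := ih (k + 2) (by omega) (by omega)
      have ih1 := ih (k + 1) (by omega) (by omega)
      have hU := Z_add_two n 0 k
      refine ⟨fun j h1 h2 => ?_, fun l h => ?_⟩
      · rw [Z_add_two n 0 (k + 1)]
        rcases (by omega : j = 0 + (k + 1) + 1 ∨ j = 0 + k + 1 ∨ j ≤ k) with rfl | rfl | h3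
        · exact mul_central_step hsq hY
        · refine mul_central_prev hY hW hbab hbW hU ?_ (ih2.1 _ (by omega) (by omega)).symm
          simpa using ih2.2 k rfl
        · have c1 : Commute (e n j) (Z n 0 (k + 2)) := ih2.1 j h1 (by omega)
          have c2 : Commute (e n j) (Z n 0 (k + 1)) := ih1.1 j h1 (by omega)
          have c3 : Commute (e n j) (e n (0 + (k + 1) + 1)) := e_commute (by omega)
          exact ((((((c1.smul_right _).sub_right (c3.mul_right c1)).sub_right
            (c1.mul_right c3)).add_right ((c3.mul_right c2).smul_right _)).add_right
            (c3.smul_right _)).sub_right c2).eq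
      · obtain rfl : l = k + 1 := by omega
        have := mul_central_absorb (q := p (k + 1 + 1)) hsq hY hW haba hU
        rw [Z_add_two n 0 (k + 1)]
        simp only [zero_add] at this ⊢
        rw [this]
        rfl

theorem e_mul_Z {n k j : ℕ} (hk : k ≤ n) (h1 : 1 ≤ j) (h2 : j < k) :
    e n j * Z n 0 k = Z n 0 k * e n j := (Z_central_aux hk).1 j h1 h2

theorem z_succ (n k : ℕ) : z n (k + 1) = T n (k + 1) + (X : ℤ[X]) • z n k := by
  rw [z, Finset.sum_range_succ', add_comm, z, Finset.smul_sum]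
  congr 1
  · simp
  · refine Finset.sum_congr rfl fun j _ => ?_
    rw [smul_smul, pow_succ', Nat.add_sub_add_right]

/-- Put T_{k+2} = Z_{k+2} - x Z_{k+1} into the recursion for T_{k+3}: the absorption law and the
braid relation evaluate the term with four factors, and what remains is the recursion for Z. -/
theorem z_eq_Z {n k : ℕ} (hk : k ≤ n) : z n k = Z n 0 k := by
  induction k using Nat.strong_induction_on with
  | _ k ih =>
    match k with
    | 0 => simp [z, Z, T]
    | 1 => simp [z, Z, T, Finset.sum_range_succ]
    | 2 => rw [z_succ, ih 1 (by omega) (by omega), Z_two]; simp [Z, T]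
    | k + 3 =>
      have i2 := ih (k + 2) (by omega) (by omega)
      have i1 := ih (k + 1) (by omega) (by omega)
      have i0 := ih k (by omega) (by omega)
      have hT : T n (k + 2) = Z n 0 (k + 2) - (X : ℤ[X]) • Z n 0 (k + 1) := by
        rw [← i2, ← i1, z_succ]; abel
      have haba : e n (k + 2) * e n (k + 1) * e n (k + 2) = e n (k + 2) :=
        e_braid (by omega) (by omega) (by omega) (by omega) (by omega)
      have hY := e_commute_Z_of_lt (n := n) (k := k + 1) (j := k + 2) (by omega)
      have hW := e_commute_Z_of_lt (n := n) (k := k) (j := k + 2) (by omega)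
      have hb := (Z_central_aux (n := n) (k := k + 2) (by omega)).2 k rfl
      have h1 : e n (k + 2) * (e n (k + 1) * (Z n 0 (k + 2) * e n (k + 2)))
          = e n (k + 2) * Z n 0 k + p (k + 2) • e n (k + 2) := by
        rw [← mul_assoc (e n (k + 1)), hb, add_mul, mul_assoc, ← hW, mul_add, ← mul_assoc,
          ← mul_assoc, haba, smul_mul_assoc, mul_smul_comm, ← mul_assoc, haba]
      have h2 : e n (k + 2) * (e n (k + 1) * (Z n 0 (k + 1) * e n (k + 2)))
          = e n (k + 2) * Z n 0 (k + 1) := by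
        rw [← hY, ← mul_assoc, ← mul_assoc, haba]
      rw [z_succ, T_add_three, i2, i1, i0, hT, Z_add_two n 0 (k + 1)]
      simp only [mul_sub, sub_mul, mul_smul_comm, smul_mul_assoc, mul_assoc, zero_add, h1, h2]
      rw [← hY, show k + 1 + 1 = k + 2 from rfl]
      module

theorem T_succ {n k : ℕ} (hk : k + 1 ≤ n) :
    T n (k + 1) = Z n 0 (k + 1) - (X : ℤ[X]) • Z n 0 k := by
  rw [← z_eq_Z hk, ← z_eq_Z (by omega), z_succ]; abel

/-- From k = 2 on, the newest generator commutes with e_{s+1}, so the recursion passes through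
e_{s+1}, and the scalars match by the recursion for p. For k = 0, 1 it does not reach far enough,
hence the two base cases. -/
theorem e_mul_Z_shift {n s k : ℕ} (hk : s + k + 2 ≤ n) :
    e n (s + 1) * Z n s (k + 2) = e n (s + 1) * Z n (s + 2) k + p (k + 2) • e n (s + 1) := by
  induction k using Nat.strong_induction_on with
  | _ k ih =>
    match k with
    | 0 => simp [Z, p, e_mul_self]
    | 1 =>
      have haba : e n (s + 1) * e n (s + 2) * e n (s + 1) = e n (s + 1) :=
        e_braid (by omega) (by omega) (by omega) (by omega) (by omega)
      have h1 : e n (s + 1) * (e n (s + 2) * e n (s + 1)) = e n (s + 1) := by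
        rw [← mul_assoc, haba]
      have h2 : e n (s + 1) * (e n (s + 1) * e n (s + 2))
          = (X : ℤ[X]) • (e n (s + 1) * e n (s + 2)) := by
        rw [← mul_assoc, e_mul_self, smul_mul_assoc]
      rw [Z_add_two n s 1, Z_two]
      simp only [Z, p, mul_add, mul_sub, mul_smul_comm, h1, h2, e_mul_self, mul_zero, smul_zero,
        add_zero, sub_zero, show s + 1 + 1 = s + 2 from rfl]
      module
    | k + 2 =>
      have i1 := ih (k + 1) (by omega) (by omega)
      have i0 := ih k (by omega) (by omega)
      have hc : e n (s + 1) * e n (s + 2 + k + 1) = e n (s + 2 + k + 1) * e n (s + 1) :=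
        e_commute (by omega)
      have c1 : ∀ y, e n (s + 1) * (e n (s + 2 + k + 1) * y)
          = e n (s + 2 + k + 1) * (e n (s + 1) * y) := fun y => by
        rw [← mul_assoc, hc, mul_assoc]
      have i1' : ∀ y, e n (s + 1) * (Z n s (k + 3) * y)
          = e n (s + 1) * (Z n (s + 2) (k + 1) * y) + p (k + 3) • (e n (s + 1) * y) := fun y => by
        rw [← mul_assoc, i1, add_mul, mul_assoc, smul_mul_assoc]
      rw [Z_add_two n s (k + 2), Z_add_two n (s + 2) k, show s + (k + 2) + 1 = s + 2 + k + 1 by omega]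
      simp only [mul_add, mul_sub, mul_smul_comm, c1, i1', i1, i0]
      rw [hc, p_add_two (k + 2), p_add_two (k + 1)]
      module


/-! ### The products `e_1 e_3 ⋯ e_{2i-1}` and `e_i e_{i+1} ⋯ e_{j-1}` -/

/-- `e_1 e_3 ⋯ e_{2i-1}`. -/
def mm (n i : ℕ) : TL n := ((List.range i).map fun j => e n (2 * j + 1)).prod

theorem mm_zero (n : ℕ) : mm n 0 = 1 := by simp [mm]

theorem mm_succ (n i : ℕ) : mm n (i + 1) = mm n i * e n (2 * i + 1) := by
  simp [mm, List.range_succ]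

theorem mm_mem_seg (n i : ℕ) : mm n i ∈ seg n 1 (2 * i) := by
  induction i with
  | zero => rw [mm_zero]; exact one_mem _
  | succ i ih =>
    rw [mm_succ]
    exact mul_mem (seg_mono le_rfl (by omega) ih) (e_mem_seg (by omega) (by omega))

theorem mm_commute {n i b : ℕ} {y : TL n} (hy : y ∈ seg n (2 * i + 1) b) :
    Commute (mm n i) y :=
  commute_of_mem_seg
    (fun _ h1 _ => (e_commute_seg_of_le (by omega) (mm_mem_seg n i)).symm) hy

theorem mm_succ_left (n i : ℕ) : mm n (i + 1) = e n (2 * i + 1) * mm n i := by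
  rw [mm_succ, mm_commute (e_mem_seg le_rfl (Nat.lt_succ_self _))]

theorem w_self (n i : ℕ) : w n i i = 1 := by simp [w]

theorem w_eq_mul {n i j : ℕ} (h : i < j) : w n i j = e n i * w n (i + 1) j := by
  obtain ⟨d, rfl⟩ : ∃ d, j = i + 1 + d := ⟨j - (i + 1), by omega⟩
  simp [w, show i + 1 + d - i = d + 1 by omega, List.range'_succ]

theorem w_mul_w {n i j k : ℕ} (h1 : i ≤ j) (h2 : j ≤ k) : w n i j * w n j k = w n i k := by
  induction j, h1 using Nat.le_induction generalizing k with
  | base => rw [w_self, one_mul]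
  | succ j hj ih =>
    rw [← ih (k := j + 1) (by omega), ← ih (k := k) (by omega), mul_assoc,
      w_eq_mul (Nat.lt_succ_self j), w_self, mul_one, ← w_eq_mul (by omega)]

theorem w_mem_seg (n i j : ℕ) : w n i j ∈ seg n i j := by
  refine Subalgebra.list_prod_mem _ fun x hx => ?_
  obtain ⟨l, hl, rfl⟩ := List.mem_map.1 hx
  rw [List.mem_range'_1] at hl
  exact e_mem_seg (by omega) (by omega)

theorem mm_mul_w {n i k : ℕ} (h : 2 * (i + 1) ≤ k) :
    mm n (i + 1) * w n (2 * (i + 1)) k = w n (2 * i + 1) k * mm n i := by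
  rw [mm_succ, mul_assoc, show 2 * (i + 1) = 2 * i + 1 + 1 by ring, ← w_eq_mul (by omega)]
  exact mm_commute (w_mem_seg _ _ _)

/-- Move e_j up to e_{j-1} e_j, use e_j e_{j-1} e_j = e_j, and commute the two remaining words. -/
theorem e_mul_w {n b j k : ℕ} (hb : 1 ≤ b) (h1 : b < j) (h2 : j < k) (hk : k ≤ n) :
    e n j * w n b k = w n j k * w n b (j - 1) := by
  have hc : Commute (w n b (j - 1)) (w n j k) :=
    commute_of_mem_seg (fun l hl _ => (e_commute_seg_of_le (by omega) (w_mem_seg _ _ _)).symm)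
      (w_mem_seg n j k)
  have hc' : Commute (e n j) (w n b (j - 1)) := e_commute_seg_of_le (by omega) (w_mem_seg _ _ _)
  have h3 : e n j * (e n (j - 1) * w n j k) = w n j k := by
    rw [w_eq_mul h2, ← mul_assoc, ← mul_assoc,
      e_braid (by omega) (by omega) (by omega) (by omega) (by omega)]
  rw [← w_mul_w (i := b) (j := j - 1) (k := k) (by omega) (by omega), ← mul_assoc, hc', mul_assoc,
    w_eq_mul (i := j - 1) (by omega), show j - 1 + 1 = j by omega, h3, hc]

/-- Leading factors are undone one at a time by e_{a+1} e_a e_{a+1} = e_{a+1}. -/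
theorem exists_mul_w_eq {n a b j : ℕ} (ha : 1 ≤ a) (haj : a ≤ j) (hj : j < b) (hb : b ≤ n) :
    ∃ y ∈ seg n a b, y * w n a (j + 1) = e n j := by
  induction hd : j - a generalizing a with
  | zero =>
    obtain rfl : a = j := by omega
    exact ⟨1, one_mem _, by rw [w_eq_mul (by omega), w_self, mul_one, one_mul]⟩
  | succ d ih =>
    obtain ⟨y, hy, h⟩ := ih (a := a + 1) (by omega) (by omega) (by omega)
    refine ⟨y * e n (a + 1), mul_mem (seg_mono (by omega) le_rfl hy)
      (e_mem_seg (by omega) (by omega)), ?_⟩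
    rw [w_eq_mul (by omega), w_eq_mul (i := a + 1) (by omega), mul_assoc, ← mul_assoc (e n a),
      ← mul_assoc (e n (a + 1)), ← mul_assoc (e n (a + 1)),
      e_braid (by omega) (by omega) (by omega) (by omega) (by omega), ← w_eq_mul (by omega), h]

/-! ### Compressing by `e_1 e_3 ⋯ e_{2i-1}` -/

/-- Elements of the form `c` or `c e_a d` with `c`, `d` products of `e_{a+1}, …, e_{b-1}`. -/
def segGens (n a b : ℕ) : Set (TL n) :=
  {y | y ∈ seg n (a + 1) b ∨ ∃ c ∈ seg n (a + 1) b, ∃ d ∈ seg n (a + 1) b, y = c * e n a * d}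

/-- By `hQ`, c may be taken to contain e_{a+1} at most once; the outer factors e_a commute inwards
and either square or meet in e_a e_{a+1} e_a. -/
theorem e_mul_mul_e_of_span {n a b : ℕ} (ha : 1 ≤ a) (hb : b ≤ n)
    (hQ : ∀ y ∈ seg n (a + 1) b, y ∈ Submodule.span ℤ[X] (segGens n (a + 1) b))
    {c : TL n} (hc : c ∈ seg n (a + 1) b) :
    ∃ c' ∈ seg n (a + 2) b, e n a * c * e n a = e n a * c' := by
  have key : ∀ c ∈ seg n (a + 2) b, ∃ c' ∈ seg n (a + 2) b, e n a * c * e n a = e n a * c' := by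
    intro c hc
    refine ⟨(X : ℤ[X]) • c, Subalgebra.smul_mem _ hc _, ?_⟩
    rw [mul_assoc, ← (e_commute_seg_of_ge le_rfl hc).eq, ← mul_assoc, e_mul_self, smul_mul_assoc,
      mul_smul_comm]
  by_cases hab : b ≤ a + 1
  · refine key c ?_
    have h1 : seg n (a + 1) b = seg n (a + 2) b := by
      unfold seg
      rw [Set.Ico_eq_empty (by omega), Set.Ico_eq_empty (by omega)]
    exact h1 ▸ hc
  · have hs := hQ c hc
    clear hc
    induction hs using Submodule.span_induction with
    | mem x hx =>
      obtain hx | ⟨c, hc, d, hd, rfl⟩ := hx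
      · exact key x hx
      · refine ⟨c * d, mul_mem hc hd, ?_⟩
        have h1 := (e_commute_seg_of_ge (j := a) le_rfl hc).eq
        have h2 := (e_commute_seg_of_ge (j := a) le_rfl hd).eq
        calc e n a * (c * e n (a + 1) * d) * e n a
            = (e n a * c) * e n (a + 1) * (d * e n a) := by simp only [mul_assoc]
          _ = c * (e n a * e n (a + 1) * e n a) * d := by rw [h1, ← h2]; simp only [mul_assoc]
          _ = _ := by
            rw [e_braid (by omega) (by omega) (by omega) (by omega) (by omega), ← h1, mul_assoc]
    | zero => exact ⟨0, zero_mem _, by simp⟩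
    | add x y _ _ hx hy =>
      obtain ⟨c, hc, h⟩ := hx
      obtain ⟨d, hd, h'⟩ := hy
      exact ⟨c + d, add_mem hc hd, by rw [mul_add, add_mul, h, h', mul_add]⟩
    | smul r x _ hx =>
      obtain ⟨c, hc, h⟩ := hx
      exact ⟨r • c, Subalgebra.smul_mem _ hc _, by
        rw [mul_smul_comm, smul_mul_assoc, h, mul_smul_comm]⟩

/-- Two occurrences of e_a enclose a product of higher generators, which `hP` collapses to a single
e_a. -/
theorem seg_le_span_of_compress {n a b : ℕ}
    (hP : ∀ c ∈ seg n (a + 1) b, ∃ c' ∈ seg n (a + 2) b, e n a * c * e n a = e n a * c')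
    {y : TL n} (hy : y ∈ seg n a b) : y ∈ Submodule.span ℤ[X] (segGens n a b) := by
  induction hy using Algebra.adjoin_induction with
  | mem x hx =>
    obtain ⟨j, ⟨h1, h2⟩, rfl⟩ := hx
    refine Submodule.subset_span ?_
    rcases h1.eq_or_lt with rfl | h1
    · exact Or.inr ⟨1, one_mem _, 1, one_mem _, by simp⟩
    · exact Or.inl (e_mem_seg h1 h2)
  | algebraMap r => exact Submodule.subset_span (Or.inl (Subalgebra.algebraMap_mem _ r))
  | add x y _ _ hx hy => exact add_mem hx hy
  | mul x y _ _ hx hy =>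
    have h := Submodule.mul_mem_mul hx hy
    rw [Submodule.span_mul_span] at h
    refine Submodule.span_mono ?_ h
    rintro _ ⟨x, hx, y, hy, rfl⟩
    obtain hx | ⟨c, hc, d, hd, rfl⟩ := hx <;> obtain hy | ⟨c', hc', d', hd', rfl⟩ := hy
    · exact Or.inl (mul_mem hx hy)
    · exact Or.inr ⟨x * c', mul_mem hx hc', d', hd', by simp only [mul_assoc]⟩
    · exact Or.inr ⟨c, hc, d * y, mul_mem hd hy, by simp only [mul_assoc]⟩
    · obtain ⟨f, hf, h⟩ := hP (d * c') (mul_mem hd hc')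
      refine Or.inr ⟨c, hc, f * d', mul_mem (seg_mono (by omega) le_rfl hf) hd', ?_⟩
      calc c * e n a * d * (c' * e n a * d') = c * (e n a * (d * c') * e n a) * d' := by
            simp only [mul_assoc]
        _ = _ := by rw [h]; simp only [mul_assoc]

theorem seg_le_span {n a b : ℕ} (ha : 1 ≤ a) (hb : b ≤ n) {y : TL n} (hy : y ∈ seg n a b) :
    y ∈ Submodule.span ℤ[X] (segGens n a b) := by
  induction h : b - a generalizing a y with
  | zero =>
    refine Submodule.subset_span (Or.inl ?_)
    have h1 : seg n a b = seg n (a + 1) b := by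
      unfold seg
      rw [Set.Ico_eq_empty (by omega), Set.Ico_eq_empty (by omega)]
    exact h1 ▸ hy
  | succ d ih =>
    exact seg_le_span_of_compress (fun c hc => e_mul_mul_e_of_span ha hb
      (fun y hy => ih (by omega) hy (by omega)) hc) hy

theorem e_mul_mul_e {n a b : ℕ} (ha : 1 ≤ a) (hb : b ≤ n) {y : TL n} (hy : y ∈ seg n a b) :
    ∃ c ∈ seg n (a + 2) b, e n a * y * e n a = e n a * c := by
  have hP : ∀ c ∈ seg n (a + 1) b, ∃ c' ∈ seg n (a + 2) b, e n a * c * e n a = e n a * c' :=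
    fun c hc => e_mul_mul_e_of_span ha hb (fun y hy => seg_le_span (by omega) hb hy) hc
  have hs := seg_le_span ha hb hy
  clear hy
  induction hs using Submodule.span_induction with
  | mem x hx =>
    obtain hx | ⟨c, hc, d, hd, rfl⟩ := hx
    · exact hP x hx
    · obtain ⟨c', hc', h⟩ := hP c hc
      obtain ⟨d', hd', h'⟩ := hP d hd
      refine ⟨c' * d', mul_mem hc' hd', ?_⟩
      have h1 := (e_commute_seg_of_ge (j := a) le_rfl hc').eq
      calc e n a * (c * e n a * d) * e n a = (e n a * c * e n a) * (d * e n a) := by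
            simp only [mul_assoc]
        _ = c' * (e n a * d * e n a) := by rw [h, h1]; simp only [mul_assoc]
        _ = _ := by rw [h', ← mul_assoc, ← h1, mul_assoc]
  | zero => exact ⟨0, zero_mem _, by simp⟩
  | add x y _ _ hx hy =>
    obtain ⟨c, hc, h⟩ := hx
    obtain ⟨d, hd, h'⟩ := hy
    exact ⟨c + d, add_mem hc hd, by rw [mul_add, add_mul, h, h', mul_add]⟩
  | smul r x _ hx =>
    obtain ⟨c, hc, h⟩ := hx
    exact ⟨r • c, Subalgebra.smul_mem _ hc _, by
      rw [mul_smul_comm, smul_mul_assoc, h, mul_smul_comm]⟩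

theorem mm_mul_mul_mm {n b : ℕ} (i : ℕ) (hb : b ≤ n) {y : TL n} (hy : y ∈ seg n 1 b) :
    ∃ c ∈ seg n (2 * i + 1) b, mm n i * y * mm n i = mm n i * c := by
  induction i with
  | zero => exact ⟨y, hy, by simp [mm_zero]⟩
  | succ i ih =>
    obtain ⟨c, hc, h⟩ := ih
    obtain ⟨c', hc', h'⟩ := e_mul_mul_e (by omega) hb hc
    refine ⟨c', hc', ?_⟩
    calc mm n (i + 1) * y * mm n (i + 1)
        = e n (2 * i + 1) * (mm n i * y * mm n i) * e n (2 * i + 1) := by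
          rw [mm_succ_left, mul_assoc (e n _) (mm n i) y, ← mm_succ_left, mm_succ]
          simp only [mul_assoc]
      _ = (e n (2 * i + 1) * mm n i) * c * e n (2 * i + 1) := by rw [h, ← mul_assoc]
      _ = mm n i * (e n (2 * i + 1) * c * e n (2 * i + 1)) := by
          rw [← mm_succ_left, mm_succ]; simp only [mul_assoc]
      _ = _ := by rw [h', mm_succ, mul_assoc]

/-- The witness is e_2 e_4 ⋯ e_{2i}; the strict inequality leaves room for e_{2i}. -/
theorem exists_mm_mul_mul_mm {n i k : ℕ} (h : 2 * i < k) (hk : k ≤ n) :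
    ∃ u ∈ seg n 1 k, mm n i * u * mm n i = mm n i := by
  induction i with
  | zero => exact ⟨1, one_mem _, by simp [mm_zero]⟩
  | succ i ih =>
    obtain ⟨u, hu, hi⟩ := ih (by omega)
    refine ⟨u * e n (2 * i + 2), mul_mem hu (e_mem_seg (by omega) (by omega)), ?_⟩
    have hc : mm n i * e n (2 * i + 2) = e n (2 * i + 2) * mm n i :=
      mm_commute (e_mem_seg (b := 2 * i + 3) (by omega) (by omega))
    calc mm n (i + 1) * (u * e n (2 * i + 2)) * mm n (i + 1)
        = e n (2 * i + 1) * mm n i * u * (e n (2 * i + 2) * mm n i) * e n (2 * i + 1) := by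
          nth_rewrite 1 [mm_succ_left]
          rw [mm_succ]
          simp only [mul_assoc]
      _ = e n (2 * i + 1) * (mm n i * u * mm n i) * e n (2 * i + 2) * e n (2 * i + 1) := by
          rw [← hc]; simp only [mul_assoc]
      _ = mm n i * (e n (2 * i + 1) * e n (2 * i + 2) * e n (2 * i + 1)) := by
          rw [hi, ← mm_succ_left, mm_succ]; simp only [mul_assoc]
      _ = _ := by
          rw [e_braid (by omega) (by omega) (by omega) (by omega) (by omega), mm_succ]

/-! ### The eigenvalues of the central elements -/

/-- The quantity p_{i+1} p_{i+d} - p_i p_{i+d+1} does not depend on i. -/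
theorem p_mul_p (i d : ℕ) : p (i + 1) * p (i + d) = p i * p (i + d + 1) + p d := by
  induction i with
  | zero => simp [p]
  | succ i ih =>
    rw [p_add_two i, show i + 1 + d + 1 = i + d + 2 by ring, p_add_two (i + d),
      show i + 1 + d = i + d + 1 by ring]
    linear_combination ih

theorem mm_mul_Z {n : ℕ} (i d : ℕ) (h : 2 * i + d ≤ n) :
    mm n i * Z n 0 (2 * i + d)
      = mm n i * Z n (2 * i) d + (p i * p (i + d + 1)) • mm n i := by
  induction i generalizing d with
  | zero => simp [mm_zero, p]
  | succ i ih =>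
    have h1 := ih (d + 2) (by omega)
    rw [show 2 * (i + 1) + d = 2 * i + (d + 2) by ring, mm_succ_left, mul_assoc, h1, mul_add,
      ← mul_assoc, ← mm_succ_left, mm_succ, mul_assoc, e_mul_Z_shift (by omega), mul_smul_comm,
      ← mm_succ_left, mm_succ, mul_add, mul_smul_comm, mul_assoc, add_assoc, ← add_smul]
    have := p_mul_p i (d + 2)
    rw [show i + 1 + d + 1 = i + (d + 2) by ring, this, add_comm (p i * _),
      show 2 * (i + 1) = 2 * i + 2 by ring]

/-! ### The augmentation ideal -/

/-- The left ideal of `seg n a b` generated by `e_a, …, e_{b-1}`. -/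
def aug (n a b : ℕ) : Submodule ℤ[X] (TL n) :=
  Submodule.span ℤ[X] {x | ∃ y ∈ seg n a b, ∃ j, a ≤ j ∧ j < b ∧ x = y * e n j}

theorem mul_e_mem_aug {n a b j : ℕ} {y : TL n} (hy : y ∈ seg n a b) (h1 : a ≤ j) (h2 : j < b) :
    y * e n j ∈ aug n a b := Submodule.subset_span ⟨y, hy, j, h1, h2, rfl⟩

theorem mul_mem_aug {n a b : ℕ} {y c : TL n} (hy : y ∈ seg n a b) (hc : c ∈ aug n a b) :
    y * c ∈ aug n a b := by
  induction hc using Submodule.span_induction with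
  | mem x hx =>
    obtain ⟨y', hy', j, h1, h2, rfl⟩ := hx
    rw [← mul_assoc]
    exact mul_e_mem_aug (mul_mem hy hy') h1 h2
  | zero => rw [mul_zero]; exact zero_mem _
  | add x x' _ _ hx hx' => rw [mul_add]; exact add_mem hx hx'
  | smul r x _ hx => rw [mul_smul_comm]; exact Submodule.smul_mem _ _ hx

theorem exists_sub_mem_aug {n a b : ℕ} {c : TL n} (hc : c ∈ seg n a b) :
    ∃ r : ℤ[X], c - r • 1 ∈ aug n a b := by
  induction hc using Algebra.adjoin_induction with
  | mem x hx =>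
    obtain ⟨j, ⟨h1, h2⟩, rfl⟩ := hx
    exact ⟨0, by simpa using mul_e_mem_aug (one_mem _) h1 h2⟩
  | algebraMap r => exact ⟨r, by rw [Algebra.algebraMap_eq_smul_one, sub_self]; exact zero_mem _⟩
  | add x y _ _ hx hy =>
    obtain ⟨r, hr⟩ := hx
    obtain ⟨s, hs⟩ := hy
    refine ⟨r + s, ?_⟩
    convert add_mem hr hs using 1
    module
  | mul x y hx' _ hx hy =>
    obtain ⟨r, hr⟩ := hx
    obtain ⟨s, hs⟩ := hy
    refine ⟨s * r, ?_⟩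
    convert add_mem (mul_mem_aug hx' hs) (Submodule.smul_mem _ s hr) using 1
    rw [mul_sub, mul_smul_comm, mul_one, smul_sub, smul_smul]
    abel

theorem aug_mono {n a b b' : ℕ} (h : b ≤ b') : aug n a b ≤ aug n a b' :=
  Submodule.span_mono fun _ ⟨y, hy, j, h1, h2, hx⟩ =>
    ⟨y, seg_mono le_rfl h hy, j, h1, by omega, hx⟩

/-- The recursion never creates a constant term. -/
theorem Z_mem_aug (n s k : ℕ) : Z n s k ∈ aug n (s + 1) (s + k) := by
  induction k using Nat.strong_induction_on with
  | _ k ih =>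
    match k with
    | 0 => exact zero_mem _
    | 1 => exact zero_mem _
    | k + 2 =>
      have h1 := aug_mono (by omega) (ih (k + 1) (by omega)) (b' := s + (k + 2))
      have h2 := aug_mono (by omega) (ih k (by omega)) (b' := s + (k + 2))
      have h3 : e n (s + k + 1) ∈ seg n (s + 1) (s + (k + 2)) := e_mem_seg (by omega) (by omega)
      have h4 := mul_e_mem_aug (j := s + k + 1) (seg_mono le_rfl (by omega)
        (Z_mem_seg n s (k + 1)) (b' := s + (k + 2))) (by omega) (by omega)
      have h5 := mul_e_mem_aug (j := s + k + 1) (one_mem (seg n (s + 1) (s + (k + 2)))) (by omega)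
        (by omega)
      rw [one_mul] at h5
      rw [Z_add_two]
      exact sub_mem (add_mem (add_mem (sub_mem (sub_mem (Submodule.smul_mem _ _ h1)
        (mul_mem_aug h3 h1)) h4) (Submodule.smul_mem _ _ (mul_mem_aug h3 h2)))
        (Submodule.smul_mem _ _ h5)) h2


/-! ### Tableaux as integer sequences -/

/-- `g 0, …, g k` are the first parts of the entries of a tableau of length `k`. -/
structure IsPath (g : ℕ → ℕ) (k : ℕ) : Prop where
  step : ∀ j < k, g (j + 1) = g j ∨ g (j + 1) = g j + 1
  bound : ∀ j ≤ k, 2 * g j ≤ j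

theorem IsPath.of_succ {g : ℕ → ℕ} {k : ℕ} (h : IsPath g (k + 1)) : IsPath g k :=
  ⟨fun j hj => h.step j (by omega), fun j hj => h.bound j (by omega)⟩

theorem IsPath.update {g : ℕ → ℕ} {k c : ℕ} (h : IsPath g k) (hc : c = g k ∨ c = g k + 1)
    (hb : 2 * c ≤ k + 1) : IsPath (Function.update g (k + 1) c) (k + 1) := by
  have hne : ∀ j ≤ k, Function.update g (k + 1) c j = g j := fun j hj =>
    Function.update_of_ne (by omega) _ _
  refine ⟨fun j hj => ?_, fun j hj => ?_⟩
  · rw [hne j (by omega)]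
    rcases (Nat.lt_succ_iff_lt_or_eq.1 hj) with h1 | rfl
    · rw [hne (j + 1) (by omega)]
      exact h.step j h1
    · rw [Function.update_self]
      exact hc
  · rcases Nat.le_add_one_iff.1 hj with h1 | rfl
    · rw [hne j h1]
      exact h.bound j h1
    · rw [Function.update_self]
      exact hb

/-- The element `v` attached to a sequence. -/
def V (n : ℕ) (g : ℕ → ℕ) : ℕ → TL n
  | 0 => 1
  | k + 1 => if g k = g (k + 1) then V n g k else w n (2 * g (k + 1)) (k + 1) * V n g k

/-- The Murphy element, in the algebra, attached to a sequence. -/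
def M (n : ℕ) (g : ℕ → ℕ) (k : ℕ) : TL n := mm n (g k) * V n g k

theorem V_congr {n k : ℕ} {g g' : ℕ → ℕ} (h : ∀ j ≤ k, g j = g' j) : V n g k = V n g' k := by
  induction k with
  | zero => rfl
  | succ k ih => rw [V, V, ih fun j hj => h j (by omega), h k (by omega), h (k + 1) le_rfl]

theorem M_congr {n k : ℕ} {g g' : ℕ → ℕ} (h : ∀ j ≤ k, g j = g' j) : M n g k = M n g' k := by
  rw [M, M, V_congr h, h k le_rfl]

theorem M_update (n : ℕ) (g : ℕ → ℕ) (k c : ℕ) : M n (Function.update g (k + 1) c) k = M n g k :=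
  M_congr fun _ _ => Function.update_of_ne (by omega) _ _

theorem V_mem_seg {n k : ℕ} {g : ℕ → ℕ} (h : IsPath g k) : V n g k ∈ seg n 1 k := by
  induction k with
  | zero => exact one_mem _
  | succ k ih =>
    have h1 := seg_mono (b' := k + 1) le_rfl (by omega) (ih h.of_succ)
    rw [V]
    split_ifs with hg
    · exact h1
    · have := h.step k (by omega)
      exact mul_mem (seg_mono (by omega) le_rfl (w_mem_seg _ _ _)) h1

theorem M_succ_of_eq {n k : ℕ} {g : ℕ → ℕ} (h : g (k + 1) = g k) : M n g (k + 1) = M n g k := by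
  rw [M, V, if_pos h.symm, h, M]

/-- Expresses a rising step as left multiplication of the whole Murphy element, so that congruences
at length k carry over to k+1. -/
theorem M_succ_of_step {n k : ℕ} {g : ℕ → ℕ} (h : g (k + 1) = g k + 1)
    (hb : 2 * g (k + 1) ≤ k + 1) : M n g (k + 1) = w n (2 * g k + 1) (k + 1) * M n g k := by
  rw [M, V, if_neg (by omega), h, ← mul_assoc, mm_mul_w (by omega), mul_assoc, M]

/-- Joining two adjacent through strands in the Murphy element of `g` gives the Murphy element of a
sequence above `g`. -/
theorem w_mul_M {n k : ℕ} {g : ℕ → ℕ} (hk : k ≤ n) (hg : IsPath g k) {j : ℕ}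
    (h1 : 2 * g k + 1 ≤ j) (h2 : j < k) :
    ∃ g', IsPath g' k ∧ (∀ l ≤ k, g l ≤ g' l) ∧ g' k = g k + 1 ∧
      w n (2 * g k + 1) (j + 1) * M n g k = M n g' k := by
  induction k generalizing j with
  | zero => omega
  | succ k ih =>
    rcases hg.step k (by omega) with hs | hs
    · rw [hs] at h1 ⊢
      rw [M_succ_of_eq hs]
      by_cases hj : j < k
      · obtain ⟨g', hp, hle, hgk, hM⟩ := ih (by omega) hg.of_succ h1 hj
        refine ⟨Function.update g' (k + 1) (g' k), hp.update (Or.inl rfl)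
          (by have := hp.bound k le_rfl; omega), fun l hl => ?_, ?_, ?_⟩
        · rcases Nat.le_add_one_iff.1 hl with hl | rfl
          · rw [Function.update_of_ne (by omega)]
            exact hle l hl
          · rw [Function.update_self]
            omega
        · rw [Function.update_self, hgk]
        · rw [hM, M_succ_of_eq (by rw [Function.update_self, Function.update_of_ne (by omega)]),
            M_update]
      -- The word is exactly the factor of a rising last step, so only the last entry of g changes.
      · obtain rfl : j = k := by omega
        refine ⟨Function.update g (j + 1) (g j + 1), hg.of_succ.update (Or.inr rfl) (by omega),
          fun l hl => ?_, Function.update_self .., ?_⟩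
        · rcases Nat.le_add_one_iff.1 hl with hl | rfl
          · rw [Function.update_of_ne (by omega)]
          · rw [Function.update_self]
            omega
        · have hne : Function.update g (j + 1) (g j + 1) j = g j :=
            Function.update_of_ne (by omega) _ _
          rw [M_succ_of_step (by rw [Function.update_self, hne])
            (by rw [Function.update_self]; omega), M_update, hne]
    -- Write f for the last entry of g. By `e_mul_w`, e_j slides through the factor of the last step
    -- and leaves w_{2f-1,j-1} acting at length k: the induction hypothesis at j - 2.
    · obtain ⟨g', hp, hle, hgk, hM⟩ := ih (j := j - 2) (by omega) hg.of_succ (by omega) (by omega)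
      have hne : Function.update g' (k + 1) (g' k + 1) k = g' k :=
        Function.update_of_ne (by omega) _ _
      refine ⟨Function.update g' (k + 1) (g' k + 1), hp.update (Or.inr rfl) (by omega),
        fun l hl => ?_, ?_, ?_⟩
      · rcases Nat.le_add_one_iff.1 hl with hl | rfl
        · rw [Function.update_of_ne (by omega)]
          exact hle l hl
        · rw [Function.update_self]
          omega
      · rw [Function.update_self, hgk, hs]
      · rw [M_succ_of_step (g := Function.update g' (k + 1) (g' k + 1))
            (by rw [Function.update_self, hne]) (by rw [Function.update_self]; omega), M_update,
          hne, ← hM, M_succ_of_step hs (by omega), ← mul_assoc,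
          ← w_mul_w (i := 2 * g (k + 1) + 1) (j := j) (by omega) (by omega),
          w_eq_mul (i := j) (by omega), w_self, mul_one, mul_assoc (w n _ j),
          e_mul_w (by omega) (by omega) h2 hk, ← mul_assoc (w n _ j),
          w_mul_w (by omega) (by omega), show j - 2 + 1 = j - 1 by omega, hgk, hs, mul_assoc]

/-- `g'` is a sequence strictly above `g`. -/
structure Above (g g' : ℕ → ℕ) (k : ℕ) : Prop where
  path : IsPath g' k
  le : ∀ l ≤ k, g l ≤ g' l
  lt : ∃ l ≤ k, g l < g' l

theorem Above.update {g g' : ℕ → ℕ} {k c : ℕ} (h : Above g g' k) (hc : c = g' k ∨ c = g' k + 1)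
    (hb : 2 * c ≤ k + 1) (hle : g (k + 1) ≤ c) :
    Above g (Function.update g' (k + 1) c) (k + 1) := by
  have hne : ∀ j ≤ k, Function.update g' (k + 1) c j = g' j := fun j hj =>
    Function.update_of_ne (by omega) _ _
  refine ⟨h.path.update hc hb, fun l hl => ?_, ?_⟩
  · rcases Nat.le_add_one_iff.1 hl with hl | rfl
    · rw [hne l hl]
      exact h.le l hl
    · rw [Function.update_self]
      exact hle
  · obtain ⟨l, hl, hlt⟩ := h.lt
    exact ⟨l, by omega, by rwa [hne l hl]⟩

/-! ### The span of the Murphy elements above a given one -/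

/-- The span of the Murphy elements of the sequences strictly above `g` with the same end, and of
the multiples of the Murphy elements of the sequences above `g` with a larger end. -/
def above (n : ℕ) (g : ℕ → ℕ) (k : ℕ) : Submodule ℤ[X] (TL n) :=
  Submodule.span ℤ[X]
    ({x | ∃ g', Above g g' k ∧ g' k = g k ∧ x = M n g' k} ∪
      {x | ∃ g', Above g g' k ∧ g k < g' k ∧ ∃ y ∈ seg n 1 k, x = mm n (g k) * y * M n g' k})

theorem above_mono {n k : ℕ} {g g' : ℕ → ℕ} (h : Above g g' k) (hk : g' k = g k) :
    above n g' k ≤ above n g k := by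
  have ht : ∀ g'', Above g' g'' k → Above g g'' k := fun g'' h' =>
    ⟨h'.path, fun l hl => (h.le l hl).trans (h'.le l hl), by
      obtain ⟨l, hl, hlt⟩ := h.lt
      exact ⟨l, hl, hlt.trans_le (h'.le l hl)⟩⟩
  refine Submodule.span_mono (Set.union_subset_union ?_ ?_)
  · rintro _ ⟨g'', h', h1, rfl⟩
    exact ⟨g'', ht _ h', h1.trans hk, rfl⟩
  · rintro _ ⟨g'', h', h1, y, hy, rfl⟩
    exact ⟨g'', ht _ h', hk ▸ h1, y, hy, by rw [hk]⟩

theorem aug_mul_M_mem_above {n k : ℕ} {g : ℕ → ℕ} (hk : k ≤ n) (hg : IsPath g k) {c : TL n}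
    (hc : c ∈ aug n (2 * g k + 1) k) : c * M n g k ∈ above n g k := by
  induction hc using Submodule.span_induction with
  | mem x hx =>
    obtain ⟨y, hy, j, h1, h2, rfl⟩ := hx
    obtain ⟨g', hp, hle, hgk, hM⟩ := w_mul_M hk hg h1 h2
    obtain ⟨y', hy', hy''⟩ := exists_mul_w_eq (n := n) (by omega) h1 h2 hk
    -- Generators of `above` with larger end must start with e_1 e_3 ⋯; u serves to create that left
    -- factor.
    obtain ⟨u, hu, hu'⟩ := exists_mm_mul_mul_mm (n := n) (i := g k) (k := k) (by omega) hk
    refine Submodule.subset_span (Or.inr ⟨g', ⟨hp, hle, k, le_rfl, by omega⟩, by omega,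
      u * (y * y'), mul_mem hu (seg_mono (by omega) le_rfl (mul_mem hy hy')), ?_⟩)
    have hcomm : mm n (g k) * (y * e n j) = y * e n j * mm n (g k) :=
      mm_commute (mul_mem hy (e_mem_seg h1 h2))
    calc y * e n j * M n g k = (y * e n j * mm n (g k)) * V n g k := by
          rw [M, ← mul_assoc]
      _ = (mm n (g k) * u) * (mm n (g k) * (y * e n j)) * V n g k := by
          rw [← hcomm, ← mul_assoc (mm n (g k) * u), hu']
      _ = mm n (g k) * (u * (y * e n j)) * M n g k := by rw [hcomm, M]; simp only [mul_assoc]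
      _ = mm n (g k) * (u * (y * y')) * (w n (2 * g k + 1) (j + 1) * M n g k) := by
          rw [← hy'']; simp only [mul_assoc]
      _ = _ := by rw [hM]
  | zero => rw [zero_mul]; exact zero_mem _
  | add x y _ _ hx hy => rw [add_mul]; exact add_mem hx hy
  | smul r x _ hx => rw [smul_mul_assoc]; exact Submodule.smul_mem _ _ hx

/-- If the ends agree, compression turns y into some c beyond the caps; its constant term gives a
multiple of M_{g'}, and the rest is above g', hence above g. -/
theorem mm_mul_M_mem_above {n k : ℕ} {g g' : ℕ → ℕ} (hk : k ≤ n) (h : Above g g' k)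
    {y : TL n} (hy : y ∈ seg n 1 k) : mm n (g k) * y * M n g' k ∈ above n g k := by
  rcases (h.le k le_rfl).eq_or_lt with he | hlt
  · obtain ⟨c, hc, hc'⟩ := mm_mul_mul_mm (g k) hk hy
    obtain ⟨r, hr⟩ := exists_sub_mem_aug hc
    have h1 : mm n (g k) * y * M n g' k = r • M n g' k + (c - r • 1) * M n g' k := by
      rw [sub_mul, smul_mul_assoc, one_mul, add_sub_cancel, M, ← he, ← mul_assoc, hc',
        mm_commute hc, mul_assoc]
    rw [h1]
    refine add_mem (Submodule.smul_mem _ _ (Submodule.subset_span (Or.inl ⟨g', h, he.symm, rfl⟩)))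
      (above_mono h he.symm (aug_mul_M_mem_above hk h.path ?_))
    rwa [← he]
  · exact Submodule.subset_span (Or.inr ⟨g', h, hlt, y, hy, rfl⟩)

/-- Repeating the last entry of a path does not change its Murphy element. -/
theorem above_le_of_eq {n k : ℕ} {g : ℕ → ℕ} (h : g (k + 1) = g k) :
    above n g k ≤ above n g (k + 1) := by
  have hU : ∀ g', Above g g' k → Above g (Function.update g' (k + 1) (g' k)) (k + 1) ∧
      M n g' k = M n (Function.update g' (k + 1) (g' k)) (k + 1) := fun g' h' =>
    ⟨h'.update (Or.inl rfl) (by have := h'.path.bound k le_rfl; omega)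
      (h ▸ h'.le k le_rfl), by
      rw [M_succ_of_eq (by rw [Function.update_self, Function.update_of_ne (by omega)]),
        M_update]⟩
  refine Submodule.span_mono (Set.union_subset_union ?_ ?_)
  · rintro _ ⟨g', h', h1, rfl⟩
    exact ⟨_, (hU g' h').1, by rw [Function.update_self, h, h1], (hU g' h').2⟩
  · rintro _ ⟨g', h', h1, y, hy, rfl⟩
    refine ⟨_, (hU g' h').1, by rw [Function.update_self, h]; exact h1, y,
      seg_mono le_rfl (by omega) hy, by rw [h, (hU g' h').2]⟩

theorem w_mul_mem_above {n k : ℕ} {g : ℕ → ℕ} (hk : k + 1 ≤ n) (h : g (k + 1) = g k + 1)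
    (hb : 2 * g (k + 1) ≤ k + 1) {x : TL n} (hx : x ∈ above n g k) :
    w n (2 * g k + 1) (k + 1) * x ∈ above n g (k + 1) := by
  induction hx using Submodule.span_induction with
  | mem x hx =>
    rcases hx with ⟨g', h', h1, rfl⟩ | ⟨g', h', h1, y, hy, rfl⟩
    · refine Submodule.subset_span (Or.inl ⟨Function.update g' (k + 1) (g' k + 1),
        h'.update (Or.inr rfl) (by omega) (by omega), by rw [Function.update_self, h, h1], ?_⟩)
      have hne : Function.update g' (k + 1) (g' k + 1) k = g' k :=
        Function.update_of_ne (by omega) _ _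
      rw [M_succ_of_step (by rw [Function.update_self, hne])
        (by rw [Function.update_self]; omega), M_update, hne, h1]
    · have h2 : w n (2 * g k + 1) (k + 1) * (mm n (g k) * y * M n g' k)
          = mm n (g (k + 1)) * (w n (2 * g (k + 1)) (k + 1) * y)
            * M n (Function.update g' (k + 1) (g' k)) (k + 1) := by
        rw [M_succ_of_eq (by rw [Function.update_self, Function.update_of_ne (by omega)]),
          M_update, h, ← mul_assoc (mm n (g k + 1)), mm_mul_w (by omega)]
        simp only [mul_assoc]
      rw [h2]
      -- After g rises and g' stays, the two ends may coincide, so the product need not be a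
      -- generator of `above`.
      exact mm_mul_M_mem_above hk (h'.update (Or.inl rfl)
        (by have := h'.path.bound k le_rfl; omega) (by omega))
        (mul_mem (seg_mono (by omega) le_rfl (w_mem_seg _ _ _)) (seg_mono le_rfl (by omega) hy))
  | zero => rw [mul_zero]; exact zero_mem _
  | add x y _ _ hx hy => rw [mul_add]; exact add_mem hx hy
  | smul r x _ hx => rw [mul_smul_comm]; exact Submodule.smul_mem _ _ hx

/-- The central elements act triangularly on the Murphy elements. -/
theorem M_mul_Z_sub_mem_above {n k l : ℕ} {g : ℕ → ℕ} (hkl : k ≤ l) (hl : l ≤ n)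
    (hg : IsPath g l) :
    M n g l * Z n 0 k - (p (g k) * p (k - g k + 1)) • M n g l ∈ above n g l := by
  induction l, hkl using Nat.le_induction with
  | base =>
    have hb := hg.bound k le_rfl
    have hc : V n g k * Z n 0 k = Z n 0 k * V n g k :=
      (commute_of_mem_seg (fun j h1 h2 => (e_mul_Z hl h1 h2).symm) (V_mem_seg hg)).symm.eq
    have hm := mm_mul_Z (n := n) (g k) (k - 2 * g k) (by omega)
    have hZ := Z_mem_seg n (2 * g k) (k - 2 * g k)
    have hZ' := Z_mem_aug n (2 * g k) (k - 2 * g k)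
    rw [show 2 * g k + (k - 2 * g k) = k by omega] at hm hZ hZ'
    rw [show g k + (k - 2 * g k) + 1 = k - g k + 1 by omega] at hm
    have h1 : M n g k * Z n 0 k - (p (g k) * p (k - g k + 1)) • M n g k
        = Z n (2 * g k) (k - 2 * g k) * M n g k := by
      rw [M, mul_assoc, hc, ← mul_assoc, hm, add_mul, smul_mul_assoc, add_sub_cancel_right,
        mm_commute hZ, mul_assoc]
    rw [h1]
    exact aug_mul_M_mem_above hl hg hZ'
  | succ l hkl ih =>
    have ih := ih (by omega) hg.of_succ
    have hb := hg.bound (l + 1) le_rfl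
    rcases hg.step l (by omega) with hs | hs
    · rw [M_succ_of_eq hs]
      exact above_le_of_eq hs ih
    · rw [M_succ_of_step hs hb, mul_assoc, ← mul_smul_comm, ← mul_sub]
      exact w_mul_mem_above hl hs hb ih


/-! ### Comparison with tableaux -/

section Tableau

variable {n : ℕ} {lam : Partition n}

/-- The sequence of first parts of a tableau. -/
def Tableau.seq (t : Tableau lam) (k : ℕ) : ℕ :=
  if h : k ≤ n then (t.shapeAt k h).fst else 0

theorem Tableau.seq_eq (t : Tableau lam) {k : ℕ} (h : k ≤ n) :
    t.seq k = (t.shapeAt k h).fst := dif_pos h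

theorem Tableau.seq_last (t : Tableau lam) : t.seq n = lam.fst := by
  rw [t.seq_eq le_rfl]
  exact congrArg Partition.fst t.shape_last

theorem Tableau.isPath_seq (t : Tableau lam) : IsPath t.seq n := by
  refine ⟨fun j hj => ?_, fun j hj => ?_⟩
  · rw [t.seq_eq hj.le, t.seq_eq hj]
    rcases t.step ⟨j, hj⟩ with h | h
    · exact Or.inl h.1.symm
    · exact Or.inr h.1.symm
  · rw [t.seq_eq hj]
    have := (t.shapeAt j hj).sum_eq
    omega

theorem Tableau.vAt_eq (t : Tableau lam) (k : ℕ) (hk : k ≤ n) : t.vAt k hk = V n t.seq k := by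
  induction k with
  | zero => rfl
  | succ k ih => rw [Tableau.vAt, V, ih, t.seq_eq hk, t.seq_eq (Nat.le_of_succ_le hk)]

theorem Tableau.mPart_mul_v (t : Tableau lam) : mPart lam * t.v = M n t.seq n := by
  rw [M, t.seq_last, Tableau.v, t.vAt_eq]
  rfl

/-- The tableau with a given sequence of first parts. -/
def IsPath.tableau {g : ℕ → ℕ} (h : IsPath g n) (hl : g n = lam.fst) : Tableau lam where
  shape k := ⟨g k, k - 2 * g k, by have := h.bound k (Nat.le_of_lt_succ k.2); omega⟩
  shape_zero := by
    have := h.bound 0 (Nat.zero_le _)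
    refine ⟨?_, ?_⟩ <;> simp only [Fin.val_zero] <;> omega
  step k := by
    have h1 := h.step k k.2
    have h2 := h.bound k k.2.le
    have h3 := h.bound (k + 1) k.2
    simp only [Arrow, Fin.val_castSucc, Fin.val_succ]
    omega
  shape_last := by
    have := lam.sum_eq
    refine Partition.ext hl ?_
    simp only [Fin.val_last]
    omega

theorem IsPath.seq_tableau {g : ℕ → ℕ} (h : IsPath g n) (hl : g n = lam.fst) {k : ℕ}
    (hk : k ≤ n) : (h.tableau hl).seq k = g k := by
  rw [Tableau.seq_eq _ hk]
  rfl

theorem Above.strictDominates_tableau {g : ℕ → ℕ} {t : Tableau lam} (h : Above t.seq g n)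
    (hl : g n = lam.fst) : (h.path.tableau hl).StrictDominates t := by
  refine ⟨fun k hk _ => ?_, fun he => ?_⟩
  · have := h.le k hk
    rw [t.seq_eq hk] at this
    exact this
  · obtain ⟨l, hl', hlt⟩ := h.lt
    rw [← h.path.seq_tableau hl hl', he] at hlt
    exact lt_irrefl _ hlt

theorem mem_checkIdeal {i : ℕ} (h : lam.fst < i) (hi : 2 * i ≤ n) (y y' : TL n) :
    y * mm n i * y' ∈ checkIdeal lam := by
  let μ : Partition n := ⟨i, n - 2 * i, by omega⟩
  have h1 : idealOf μ ≤ checkIdeal lam :=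
    le_iSup₂_of_le (f := fun (μ : Partition n) (_ : μ.StrictDominates lam) => idealOf μ) μ
      ⟨h.le, fun he => h.ne (congrArg Partition.fst he).symm⟩ le_rfl
  have h2 : mm n i ∈ checkIdeal lam :=
    h1 (TwoSidedIdeal.subset_span (Set.mem_singleton (mPart μ)))
  exact (checkIdeal lam).mul_mem_right _ _ ((checkIdeal lam).mul_mem_left _ _ h2)

theorem Tableau.coe_m (t : Tableau lam) :
    (t.m : TL n ⧸ checkRight lam) = (checkRight lam).mkQ (M n t.seq n) := by
  rw [← t.mPart_mul_v]
  rfl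

/-- The span of the Murphy basis elements that strictly dominate `t`. -/
def dominatingSpan (t : Tableau lam) : Submodule ℤ[X] (Cell lam) :=
  Submodule.span ℤ[X] (Tableau.m '' {v | v.StrictDominates t})

theorem exists_mem_dominatingSpan {t : Tableau lam} {x : TL n} (hx : x ∈ above n t.seq n) :
    ∃ y ∈ dominatingSpan t, (y : TL n ⧸ checkRight lam) = (checkRight lam).mkQ x := by
  induction hx using Submodule.span_induction with
  | mem x hx =>
    rcases hx with ⟨g, h, hg, rfl⟩ | ⟨g, h, hg, y, hy, rfl⟩
    · rw [t.seq_last] at hg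
      refine ⟨(h.path.tableau hg).m,
        Submodule.subset_span ⟨_, h.strictDominates_tableau hg, rfl⟩, ?_⟩
      rw [Tableau.coe_m, M_congr fun j hj => h.path.seq_tableau hg hj]
    -- The end exceeds the first part of λ, so the term lies in the ideal factored out.
    · refine ⟨0, zero_mem _, ?_⟩
      rw [t.seq_last] at hg
      rw [Submodule.coe_zero, eq_comm, Submodule.mkQ_apply, Submodule.Quotient.mk_eq_zero, M,
        ← mul_assoc]
      exact mem_checkIdeal hg (h.path.bound n le_rfl) _ _
  | zero => exact ⟨0, zero_mem _, by simp⟩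
  | add x y _ _ hx hy =>
    obtain ⟨a, ha, h⟩ := hx
    obtain ⟨b, hb, h'⟩ := hy
    exact ⟨a + b, add_mem ha hb, by rw [Submodule.coe_add, h, h', map_add]⟩
  | smul r x _ hx =>
    obtain ⟨a, ha, h⟩ := hx
    refine ⟨r • a, Submodule.smul_mem _ _ ha, ?_⟩
    rw [Submodule.coe_smul_of_tower, h]
    rfl

theorem Z_smul_m_sub_mem (t : Tableau lam) {k : ℕ} (hk : k ≤ n) :
    MulOpposite.op (Z n 0 k) • t.m - (p (t.seq k) * p (k - t.seq k + 1)) • t.m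
      ∈ dominatingSpan t := by
  obtain ⟨y, hy, h⟩ := exists_mem_dominatingSpan (M_mul_Z_sub_mem_above hk le_rfl t.isPath_seq)
  convert hy
  refine Subtype.ext ?_
  rw [h, map_sub, Submodule.coe_sub, Submodule.coe_smul, Submodule.coe_smul_of_tower, t.coe_m]
  rfl

/-- A step from k to k+1 fixes k - i when i rises and fixes i otherwise, so one factor p is common
to both eigenvalues; this gives the two cases of r. -/
theorem Tableau.r_succ (t : Tableau lam) {k : ℕ} (hk : k + 1 ≤ n) :
    t.r (k + 1) hk = p (t.seq (k + 1)) * p (k + 1 - t.seq (k + 1) + 1)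
      - X * (p (t.seq k) * p (k - t.seq k + 1)) := by
  have hs := t.isPath_seq.step k hk
  have hb := t.isPath_seq.bound (k + 1) hk
  have hb' := t.isPath_seq.bound k (by omega)
  match k with
  | 0 =>
    rw [show t.seq (0 + 1) = 0 by omega, show t.seq 0 = 0 by omega]
    simp [Tableau.r, p]
  | k + 1 =>
    rw [Tableau.r, ← t.seq_eq, ← t.seq_eq]
    change t.seq (k + 2) = _ ∨ t.seq (k + 2) = _ at hs
    rcases hs with hs | hs
    · rw [if_neg (by omega), hs, show k + 1 - t.seq (k + 1) + 1 = k + 2 - t.seq (k + 1) by omega]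
      ring
    · rw [if_pos hs.symm, hs, Nat.add_sub_cancel,
        show k + 2 - (t.seq (k + 1) + 1) + 1 = k + 1 - t.seq (k + 1) + 1 by omega]
      ring

theorem T_smul_m_sub_mem (t : Tableau lam) {k : ℕ} (hk : k ≤ n) :
    MulOpposite.op (T n k) • t.m - t.r k hk • t.m ∈ dominatingSpan t := by
  match k with
  | 0 => simp [T, Tableau.r]
  | k + 1 =>
    have h := sub_mem (Z_smul_m_sub_mem t hk)
      (Submodule.smul_mem _ (X : ℤ[X]) (Z_smul_m_sub_mem t (Nat.le_of_succ_le hk)))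
    convert h using 1
    have h1 : MulOpposite.op (T n (k + 1)) • t.m
        = MulOpposite.op (Z n 0 (k + 1)) • t.m - (X : ℤ[X]) • MulOpposite.op (Z n 0 k) • t.m := by
      rw [T_succ hk, ← smul_assoc, ← MulOpposite.op_smul]
      exact sub_smul (MulOpposite.op (Z n 0 (k + 1))) (MulOpposite.op ((X : ℤ[X]) • Z n 0 k)) t.m
    have h2 (a b : ℤ[X]) : (a - X * b) • t.m = a • t.m - (X : ℤ[X]) • b • t.m := by
      rw [smul_smul]
      exact sub_smul a (X * b) t.m
    rw [h1, t.r_succ hk, h2, smul_sub]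
    abel

end Tableau

end TemperleyLieb

end

open TemperleyLieb Polynomial in
open scoped Classical in
theorem mainTheorem3 (n : ℕ) (lam : TemperleyLieb.Partition n) (t : Tableau lam)
    (k : ℕ) (hk : k ≤ n) :
    ∃ a : Tableau lam → ℤ[X],
      MulOpposite.op (T n k) • t.m
        = t.r k hk • t.m + ∑ v : Tableau lam with v.StrictDominates t, a v • v.m := by
  have h := T_smul_m_sub_mem t hk
  have hset : Tableau.m '' {v : Tableau lam | v.StrictDominates t}
      = Tableau.m '' ↑(Finset.univ.filter fun v : Tableau lam => v.StrictDominates t) := by simp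
  rw [dominatingSpan, hset, Submodule.mem_span_image_finset_iff_exists_fun'] at h
  obtain ⟨a, ha⟩ := h
  exact ⟨a, by rw [ha]; abel⟩
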